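/- Let $1\le p<\infty$ and let $E$ and $F$ be real Banach spaces. For a positively homogeneous function $f\colon E^*\to\mathbb R$, set \[ \|f\|_{\mathrm{FBL}^p[E]}=\sup\Bigl\{\Bigl(\sum_{j=1}^n|f(x_j^*)|^p\Bigr)^{1/p} : n\in\mathbb N,\ x_1^*,\dots,x_n^*\in E^*,\ \sup_{\|x\|\le1}\Bigl(\sum_{j=1}^n|x_j^*(x)|^p\Bigr)^{1/p}\le1\Bigr\}, \] let $H^p[E]$ be the Banach lattice (with pointwise operations) of those positively homogeneous $f$ for which this norm is finite, and let $\mathrm{FBL}^p[E]$ be the closed sublattice of $H^p[E]$ generated by the evaluations $\delta_x\colon x^*\mapsto x^*(x)$, $x\in E$. Write $\delta^E\colon E\to\mathrm{FBL}^p[E]$ for the map $x\mapsto\delta_x$, and similarly for $F$. For a bounded linear operator $S\colon E\to F$, let $\overline S\colon\mathrm{FBL}^p[E]\to\mathrm{FBL}^p[F]$ be the unique lattice homomorphism (that is, linear map preserving finite suprema and infima) such that $\overline S\circ\delta^E=\delta^F\circ S$. Let $T\colon\mathrm{FBL}^p[E]\to\mathrm{FBL}^p[F]$ be a lattice homomorphism,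 and let $\Phi_T\colon F^*\to E^*$ be the unique map such that $Tf=f\circ\Phi_T$ for every $f\in\mathrm{FBL}^p[E]$. Then the following four conditions are equivalent: (a) $\Phi_T$ is linear; (b) $\Phi_T=S^*$ for some bounded linear operator $S\colon E\to F$; (c) $T\circ\delta^E=\delta^F\circ S$ for some bounded linear operator $S\colon E\to F$; (d) $T=\overline S$ for some bounded linear operator $S\colon E\to F$. -/

import Mathlib

open scoped ENNReal

/-- The `ℓ_p`-norm `(∑_j |t_j|^p)^(1/p)` of a finite family of real numbers. -/
noncomputable def lpSum (p : ℝ) {n : ℕ} (t : Fin n → ℝ) : ℝ :=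
  (∑ j, |t j| ^ p) ^ (1 / p)

/-- The vector lattice homomorphisms: linear maps which preserve finite suprema and infima. -/
structure VectorLatticeHom (X Y : Type*) [AddCommGroup X] [Module ℝ X] [Lattice X]
    [AddCommGroup Y] [Module ℝ Y] [Lattice Y] extends X →ₗ[ℝ] Y where
  map_sup' : ∀ f g : X, toFun (f ⊔ g) = toFun f ⊔ toFun g
  map_inf' : ∀ f g : X, toFun (f ⊓ g) = toFun f ⊓ toFun g

instance {X Y : Type*} [AddCommGroup X] [Module ℝ X] [Lattice X]
    [AddCommGroup Y] [Module ℝ Y] [Lattice Y] :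
    CoeFun (VectorLatticeHom X Y) (fun _ => X → Y) :=
  ⟨fun T => T.toLinearMap⟩

theorem VectorLatticeHom.ext_fun {X Y : Type*} [AddCommGroup X] [Module ℝ X] [Lattice X]
    [AddCommGroup Y] [Module ℝ Y] [Lattice Y] {T U : VectorLatticeHom X Y}
    (h : ∀ f, T f = U f) : T = U := by
  obtain ⟨T, _, _⟩ := T
  obtain ⟨U, _, _⟩ := U
  have : T = U := LinearMap.ext h
  subst this
  rfl

section Construction

variable {E : Type*} [NormedAddCommGroup E] [NormedSpace ℝ E]

/-- The weak `p`-summing norm of a finite family in the dual of `E`. -/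
noncomputable def weakSummingNorm (p : ℝ) {n : ℕ} (xs : Fin n → StrongDual ℝ E) : ℝ≥0∞ :=
  ⨆ (x : E) (_ : ‖x‖ ≤ 1), ENNReal.ofReal (lpSum p fun j => xs j x)

/-- The (possibly infinite) `FBL^p`-norm of a real function on the dual of `E`. -/
noncomputable def fblNorm (p : ℝ) (f : StrongDual ℝ E → ℝ) : ℝ≥0∞ :=
  ⨆ (n : ℕ) (xs : Fin n → StrongDual ℝ E) (_ : weakSummingNorm p xs ≤ 1),
    ENNReal.ofReal (lpSum p fun j => f (xs j))

variable (E) in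
/-- `H[E]`: the positively homogeneous real functions on the dual of `E`. -/
def posHomFun : Submodule ℝ (StrongDual ℝ E → ℝ) where
  carrier := {f | ∀ (r : ℝ) (y : StrongDual ℝ E), 0 ≤ r → f (r • y) = r * f y}
  add_mem' := by
    intro f g hf hg r y hr
    simp only [Pi.add_apply, hf r y hr, hg r y hr]; ring
  zero_mem' := by intro r y _; simp
  smul_mem' := by
    intro c f hf r y hr
    simp only [Pi.smul_apply, smul_eq_mul, hf r y hr]; ring

theorem lpSum_mono {p : ℝ} (hp : 1 ≤ p) {n : ℕ} {s t : Fin n → ℝ} (h : ∀ j, |s j| ≤ |t j|) :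
    lpSum p s ≤ lpSum p t := by
  unfold lpSum
  refine Real.rpow_le_rpow (Finset.sum_nonneg fun j _ => by positivity) ?_ (by positivity)
  exact Finset.sum_le_sum fun j _ => Real.rpow_le_rpow (abs_nonneg _) (h j) (by linarith)

theorem lpSum_smul {p : ℝ} (hp : 1 ≤ p) {n : ℕ} (c : ℝ) (t : Fin n → ℝ) :
    lpSum p (fun j => c * t j) = |c| * lpSum p t := by
  unfold lpSum
  have h : ∀ j, |c * t j| ^ p = |c| ^ p * |t j| ^ p := fun j => by
    rw [abs_mul, Real.mul_rpow (abs_nonneg _) (abs_nonneg _)]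
  simp_rw [h]
  rw [← Finset.mul_sum, Real.mul_rpow (by positivity)
    (Finset.sum_nonneg fun j _ => by positivity), ← Real.rpow_mul (abs_nonneg _),
    mul_one_div_cancel (by linarith), Real.rpow_one]

theorem fblNorm_mono {p : ℝ} (hp : 1 ≤ p) {f g : StrongDual ℝ E → ℝ}
    (h : ∀ y, |f y| ≤ |g y|) : fblNorm p f ≤ fblNorm p g := by
  unfold fblNorm
  gcongr with n xs hxs
  exact lpSum_mono hp fun j => h _

theorem le_fblNorm {p : ℝ} (f : StrongDual ℝ E → ℝ) {n : ℕ} (xs : Fin n → StrongDual ℝ E)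
    (hxs : weakSummingNorm p xs ≤ 1) :
    ENNReal.ofReal (lpSum p fun j => f (xs j)) ≤ fblNorm p f :=
  le_iSup_of_le n (le_iSup_of_le xs (le_iSup_of_le hxs le_rfl))

theorem fblNorm_le_iff {p : ℝ} {f : StrongDual ℝ E → ℝ} {c : ℝ≥0∞} :
    fblNorm p f ≤ c ↔ ∀ (n : ℕ) (xs : Fin n → StrongDual ℝ E), weakSummingNorm p xs ≤ 1 →
      ENNReal.ofReal (lpSum p fun j => f (xs j)) ≤ c := by
  simp only [fblNorm, iSup_le_iff]

theorem fblNorm_add_le {p : ℝ} (hp : 1 ≤ p) (f g : StrongDual ℝ E → ℝ) :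
    fblNorm p (f + g) ≤ fblNorm p f + fblNorm p g := by
  rw [fblNorm_le_iff]
  intro n xs hxs
  calc ENNReal.ofReal (lpSum p fun j => (f + g) (xs j))
      ≤ ENNReal.ofReal (lpSum p (fun j => f (xs j)) + lpSum p fun j => g (xs j)) :=
        ENNReal.ofReal_le_ofReal
          (Real.Lp_add_le Finset.univ (fun j => f (xs j)) (fun j => g (xs j)) hp)
    _ ≤ ENNReal.ofReal (lpSum p fun j => f (xs j))
          + ENNReal.ofReal (lpSum p fun j => g (xs j)) := ENNReal.ofReal_add_le
    _ ≤ _ := add_le_add (le_fblNorm f xs hxs) (le_fblNorm g xs hxs)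

theorem fblNorm_smul_le {p : ℝ} (hp : 1 ≤ p) (c : ℝ) (f : StrongDual ℝ E → ℝ) :
    fblNorm p (c • f) ≤ ENNReal.ofReal |c| * fblNorm p f := by
  rw [fblNorm_le_iff]
  intro n xs hxs
  have := lpSum_smul hp c fun j => f (xs j)
  simp only [Pi.smul_apply, smul_eq_mul]
  rw [this, ENNReal.ofReal_mul (abs_nonneg _)]
  gcongr
  exact le_fblNorm f xs hxs

theorem fblNorm_zero {p : ℝ} (hp : 1 ≤ p) : fblNorm p (0 : StrongDual ℝ E → ℝ) = 0 := by
  have := fblNorm_smul_le hp 0 (0 : StrongDual ℝ E → ℝ)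
  simpa using this

variable (E) in
/-- `H^p[E]`: the positively homogeneous functions of finite `FBL^p`-norm. -/
def finiteNormFun (p : ℝ) [hp : Fact (1 ≤ p)] : Submodule ℝ (StrongDual ℝ E → ℝ) where
  carrier := {f | f ∈ posHomFun E ∧ fblNorm p f < ∞}
  add_mem' := by
    rintro f g ⟨hf, hf'⟩ ⟨hg, hg'⟩
    exact ⟨add_mem hf hg,
      (fblNorm_add_le hp.out f g).trans_lt (ENNReal.add_lt_top.2 ⟨hf', hg'⟩)⟩
  zero_mem' := ⟨zero_mem _, by rw [fblNorm_zero hp.out]; exact ENNReal.zero_lt_top⟩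
  smul_mem' := by
    rintro c f ⟨hf, hf'⟩
    exact ⟨Submodule.smul_mem _ _ hf,
      (fblNorm_smul_le hp.out c f).trans_lt (ENNReal.mul_lt_top ENNReal.ofReal_lt_top hf')⟩

/-- The evaluation `δ_x : x* ↦ x*(x)` as a function on the dual of `E`. -/
def evalFun (x : E) : StrongDual ℝ E → ℝ := fun y => y x

/-- `A` is a sublattice (a linear subspace closed under the pointwise lattice operations) of
`H^p[E]` which is closed with respect to the `FBL^p`-norm. -/
structure IsClosedSublattice (p : ℝ) [Fact (1 ≤ p)]
    (A : Submodule ℝ (StrongDual ℝ E → ℝ)) : Prop where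
  le : A ≤ finiteNormFun E p
  sup_mem : ∀ f ∈ A, ∀ g ∈ A, f ⊔ g ∈ A
  inf_mem : ∀ f ∈ A, ∀ g ∈ A, f ⊓ g ∈ A
  closed : ∀ f ∈ finiteNormFun E p,
    (∀ ε : ℝ≥0∞, 0 < ε → ∃ g ∈ A, fblNorm p (f - g) < ε) → f ∈ A

variable (E) in
/-- `FBL^p[E]`: the closed sublattice of `H^p[E]` generated by the evaluations `δ_x`. -/
def freeBanachLattice (p : ℝ) [Fact (1 ≤ p)] : Submodule ℝ (StrongDual ℝ E → ℝ) :=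
  sInf {A | IsClosedSublattice p A ∧ ∀ x : E, evalFun x ∈ A}

theorem fblNorm_evalFun_le {p : ℝ} (hp : 1 ≤ p) (x : E) :
    fblNorm p (evalFun x) ≤ ENNReal.ofReal ‖x‖ := by
  rw [fblNorm_le_iff]
  intro n xs hxs
  have h1 : lpSum p (fun j => xs j (‖x‖⁻¹ • x)) ≤ 1 := by
    have : ENNReal.ofReal (lpSum p fun j => xs j (‖x‖⁻¹ • x)) ≤ 1 := by
      refine le_trans ?_ hxs
      refine le_iSup_of_le (‖x‖⁻¹ • x) (le_iSup_of_le ?_ le_rfl)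
      rw [norm_smul, norm_inv, norm_norm]
      exact inv_mul_le_one
    rwa [ENNReal.ofReal_le_one] at this
  refine ENNReal.ofReal_le_ofReal ?_
  have h2 : (fun j => evalFun x (xs j)) = fun j => ‖x‖ * xs j (‖x‖⁻¹ • x) := by
    funext j
    by_cases hx : x = 0
    · simp [hx, evalFun]
    · have : ‖x‖ ≠ 0 := norm_ne_zero_iff.2 hx
      simp only [evalFun, map_smul, smul_eq_mul]
      field_simp
  rw [h2, lpSum_smul hp, abs_norm]
  exact mul_le_of_le_one_right (norm_nonneg _) h1

theorem isClosedSublattice_finiteNormFun (p : ℝ) [hp : Fact (1 ≤ p)] :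
    IsClosedSublattice p (finiteNormFun E p) := by
  have key : ∀ f ∈ finiteNormFun E p, ∀ g ∈ finiteNormFun E p, ∀ h : StrongDual ℝ E → ℝ,
      h ∈ posHomFun E → (∀ y, |h y| ≤ |f y| + |g y|) → h ∈ finiteNormFun E p := by
    intro f hf g hg h hh hle
    refine ⟨hh, ?_⟩
    have h1 : fblNorm p h ≤ fblNorm p ((fun y => |f y|) + fun y => |g y|) :=
      fblNorm_mono hp.out fun y => (hle y).trans (le_abs_self _)
    refine (h1.trans (fblNorm_add_le hp.out _ _)).trans_lt (ENNReal.add_lt_top.2 ⟨?_, ?_⟩)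
    · exact (fblNorm_mono hp.out fun y => by simp).trans_lt hf.2
    · exact (fblNorm_mono hp.out fun y => by simp).trans_lt hg.2
  refine ⟨le_rfl, fun f hf g hg => key f hf g hg _ ?_ ?_,
    fun f hf g hg => key f hf g hg _ ?_ ?_, fun f hf _ => hf⟩
  · intro r y hr
    simp only [Pi.sup_apply, hf.1 r y hr, hg.1 r y hr]
    exact (mul_max_of_nonneg _ _ hr).symm
  · intro y
    exact abs_max_le_max_abs_abs.trans (max_le_add_of_nonneg (abs_nonneg _) (abs_nonneg _))
  · intro r y hr
    simp only [Pi.inf_apply, hf.1 r y hr, hg.1 r y hr]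
    exact (mul_min_of_nonneg _ _ hr).symm
  · intro y
    exact abs_min_le_max_abs_abs.trans (max_le_add_of_nonneg (abs_nonneg _) (abs_nonneg _))

theorem evalFun_mem_finiteNormFun (p : ℝ) [hp : Fact (1 ≤ p)] (x : E) :
    evalFun x ∈ finiteNormFun E p :=
  ⟨fun r y _ => by simp [evalFun],
    (fblNorm_evalFun_le hp.out x).trans_lt ENNReal.ofReal_lt_top⟩

theorem isClosedSublattice_freeBanachLattice (p : ℝ) [Fact (1 ≤ p)] :
    IsClosedSublattice p (freeBanachLattice E p) := by
  have hle : freeBanachLattice E p ≤ finiteNormFun E p :=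
    sInf_le ⟨isClosedSublattice_finiteNormFun p, evalFun_mem_finiteNormFun p⟩
  refine ⟨hle, fun f hf g hg => ?_, fun f hf g hg => ?_, fun f hf h => ?_⟩
  · rw [freeBanachLattice, Submodule.mem_sInf] at *
    exact fun A hA => hA.1.sup_mem f (hf A hA) g (hg A hA)
  · rw [freeBanachLattice, Submodule.mem_sInf] at *
    exact fun A hA => hA.1.inf_mem f (hf A hA) g (hg A hA)
  · rw [freeBanachLattice, Submodule.mem_sInf]
    refine fun A hA => hA.1.closed f hf fun ε hε => ?_
    obtain ⟨g, hg, hlt⟩ := h ε hε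
    exact ⟨g, (sInf_le hA : freeBanachLattice E p ≤ A) hg, hlt⟩

/-- The lattice operations of `FBL^p[E]` are the pointwise ones. -/
instance freeBanachLattice.instLattice (p : ℝ) [Fact (1 ≤ p)] :
    Lattice (freeBanachLattice E p) :=
  Subtype.lattice
    (fun f g hf hg => (isClosedSublattice_freeBanachLattice p).sup_mem f hf g hg)
    (fun f g hf hg => (isClosedSublattice_freeBanachLattice p).inf_mem f hf g hg)

variable (E) in
/-- The canonical map `δ^E : E → FBL^p[E]`, `x ↦ δ_x`. -/
def canonicalMap (p : ℝ) [Fact (1 ≤ p)] : E →ₗ[ℝ] freeBanachLattice E p where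
  toFun x := ⟨evalFun x, by
    rw [freeBanachLattice, Submodule.mem_sInf]; exact fun A hA => hA.2 x⟩
  map_add' x y := by ext z; simp [evalFun]
  map_smul' c x := by ext z; simp [evalFun]

/-- To prove a property of all members of `FBL^p[E]`, prove it on a closed sublattice
containing the evaluations. -/
theorem freeBanachLattice_le {p : ℝ} [Fact (1 ≤ p)] {A : Submodule ℝ (StrongDual ℝ E → ℝ)}
    (hA : IsClosedSublattice p A) (h : ∀ x : E, evalFun x ∈ A) : freeBanachLattice E p ≤ A :=
  sInf_le ⟨hA, h⟩

theorem weakSummingNorm_single_le {p : ℝ} (hp : 1 ≤ p) (y : StrongDual ℝ E) (hy : ‖y‖ ≤ 1) :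
    weakSummingNorm p (fun _ : Fin 1 => y) ≤ 1 := by
  simp only [weakSummingNorm, iSup_le_iff]
  intro x hx
  rw [ENNReal.ofReal_le_one]
  simp only [lpSum, Finset.univ_unique, Finset.sum_const, Finset.card_singleton, one_smul]
  rw [← Real.rpow_mul (abs_nonneg _), mul_one_div_cancel (by linarith), Real.rpow_one]
  have := y.le_opNorm x
  rw [Real.norm_eq_abs] at this
  exact this.trans (mul_le_one₀ hy (norm_nonneg _) hx)

theorem ofReal_abs_le_fblNorm {p : ℝ} (hp : 1 ≤ p) {f : StrongDual ℝ E → ℝ}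
    (hf : f ∈ posHomFun E) (y : StrongDual ℝ E) :
    ENNReal.ofReal |f y| ≤ ENNReal.ofReal ‖y‖ * fblNorm p f := by
  have h0 := le_fblNorm (p := p) f (fun _ : Fin 1 => ‖y‖⁻¹ • y)
    (weakSummingNorm_single_le hp _ (by rw [norm_smul, norm_inv, norm_norm]; exact inv_mul_le_one))
  simp only [lpSum, Finset.univ_unique, Finset.sum_const, Finset.card_singleton, one_smul] at h0
  rw [← Real.rpow_mul (abs_nonneg _), mul_one_div_cancel (by linarith), Real.rpow_one] at h0
  have h1 : f y = ‖y‖ * f (‖y‖⁻¹ • y) := by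
    rw [← hf _ _ (norm_nonneg y)]
    by_cases hy : y = 0
    · simp [hy]
    · rw [smul_smul, mul_inv_cancel₀ (norm_ne_zero_iff.2 hy), one_smul]
  rw [h1, abs_mul, abs_norm, ENNReal.ofReal_mul (norm_nonneg _)]
  gcongr

/-- The `FBL^p`-norm is lower semicontinuous for pointwise convergence. -/
theorem fblNorm_le_of_tendsto {p : ℝ} (hp : 1 ≤ p) {u : ℕ → StrongDual ℝ E → ℝ}
    {f : StrongDual ℝ E → ℝ} (hu : ∀ y, Filter.Tendsto (fun n => u n y) Filter.atTop (nhds (f y)))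
    {c : ℝ≥0∞} (hc : ∀ n, fblNorm p (u n) ≤ c) : fblNorm p f ≤ c := by
  rw [fblNorm_le_iff]
  intro m xs hxs
  have hp0 : 0 ≤ p := by linarith
  have h : Filter.Tendsto (fun n => ENNReal.ofReal (lpSum p fun j => u n (xs j))) Filter.atTop
      (nhds (ENNReal.ofReal (lpSum p fun j => f (xs j)))) := by
    refine ENNReal.tendsto_ofReal ?_
    refine Filter.Tendsto.rpow_const ?_ (Or.inr (by positivity))
    exact tendsto_finsetSum _ fun j _ =>
      (hu (xs j)).abs.rpow_const (Or.inr hp0)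
  exact le_of_tendsto' h fun n => (le_fblNorm (u n) xs hxs).trans (hc n)

theorem fblNorm_sum_le {p : ℝ} (hp : 1 ≤ p) (u : ℕ → StrongDual ℝ E → ℝ) (s : Finset ℕ) :
    fblNorm p (∑ k ∈ s, u k) ≤ ∑ k ∈ s, fblNorm p (u k) := by
  induction s using Finset.cons_induction with
  | empty => simp [fblNorm_zero hp]
  | cons a s ha ih =>
    rw [Finset.sum_cons, Finset.sum_cons]
    exact (fblNorm_add_le hp _ _).trans (by gcongr)

/-- Linear functionals on `FBL^p[E]` which preserve suprema are bounded. -/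
theorem exists_bound_of_map_sup {p : ℝ} [hp : Fact (1 ≤ p)] (φ : freeBanachLattice E p →ₗ[ℝ] ℝ)
    (hφ : ∀ f g, φ (f ⊔ g) = φ f ⊔ φ g) :
    ∃ C : ℝ, 0 ≤ C ∧ ∀ f : freeBanachLattice E p,
      |φ f| ≤ C * (fblNorm p (f : StrongDual ℝ E → ℝ)).toReal := by
  have hcl := isClosedSublattice_freeBanachLattice (E := E) p
  have hmono : ∀ f g : freeBanachLattice E p, f ≤ g → φ f ≤ φ g := by
    intro f g h
    have := hφ f g
    rw [sup_eq_right.2 h] at this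
    rw [this]
    exact le_sup_left
  have claim : ∃ n : ℕ, ∀ f : freeBanachLattice E p, 0 ≤ (f : StrongDual ℝ E → ℝ) →
      fblNorm p (f : StrongDual ℝ E → ℝ) ≤ 1 → φ f ≤ 2 ^ n := by
    by_contra! hcon
    choose f hf0 hf1 hf2 using hcon
    let g : ℕ → freeBanachLattice E p := fun n => ((1 / 2 : ℝ) ^ n) • f n
    have hg0 : ∀ n y, 0 ≤ (g n : StrongDual ℝ E → ℝ) y := fun n y =>
      mul_nonneg (by positivity) (hf0 n y)
    have hg1 : ∀ n, fblNorm p (g n : StrongDual ℝ E → ℝ) ≤ ENNReal.ofReal ((1 / 2 : ℝ) ^ n) := by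
      intro n
      refine (fblNorm_smul_le hp.out _ _).trans ?_
      rw [abs_of_nonneg (by positivity)]
      exact mul_le_of_le_one_right (zero_le) (hf1 n)
    have hg2 : ∀ n, 1 ≤ φ (g n) := by
      intro n
      have : (1 / 2 : ℝ) ^ n * 2 ^ n = 1 := by rw [← mul_pow]; norm_num
      simp only [g, map_smul, smul_eq_mul]
      refine this.symm.le.trans ?_
      exact mul_le_mul_of_nonneg_left (hf2 n).le (by positivity)
    have hbd : ∀ n y, (g n : StrongDual ℝ E → ℝ) y ≤ ‖y‖ * (1 / 2 : ℝ) ^ n := by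
      intro n y
      have h1 := ofReal_abs_le_fblNorm hp.out (hcl.le (g n).2).1 y
      have h2 := h1.trans (mul_le_mul_right (hg1 n) (ENNReal.ofReal ‖y‖))
      rw [← ENNReal.ofReal_mul (norm_nonneg _),
        ENNReal.ofReal_le_ofReal_iff (by positivity)] at h2
      exact (le_abs_self _).trans h2
    have hsum : ∀ y, Summable fun n => (g n : StrongDual ℝ E → ℝ) y := fun y =>
      Summable.of_nonneg_of_le (fun n => hg0 n y) (fun n => hbd n y)
        ((summable_geometric_of_lt_one (by norm_num) (by norm_num)).mul_left _)
    let G : StrongDual ℝ E → ℝ := fun y => ∑' n, (g n : StrongDual ℝ E → ℝ) y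
    have hGpos : G ∈ posHomFun E := by
      intro r y hr
      simp only [G]
      rw [← tsum_mul_left]
      exact tsum_congr fun n => (hcl.le (g n).2).1 r y hr
    have htail : ∀ N : ℕ,
        fblNorm p (G - ∑ k ∈ Finset.range N, (g k : StrongDual ℝ E → ℝ))
          ≤ ENNReal.ofReal (2 * (1 / 2 : ℝ) ^ N) := by
      intro N
      refine fblNorm_le_of_tendsto hp.out
        (u := fun M => ∑ k ∈ Finset.range M, (g (k + N) : StrongDual ℝ E → ℝ)) ?_ ?_
      · intro y
        have h1 := (hsum y).sum_add_tsum_nat_add N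
        have h2 := ((summable_nat_add_iff N).2 (hsum y)).hasSum.tendsto_sum_nat
        have h3 : (G - ∑ k ∈ Finset.range N, (g k : StrongDual ℝ E → ℝ)) y
            = ∑' k, (g (k + N) : StrongDual ℝ E → ℝ) y := by
          simp only [Pi.sub_apply, Finset.sum_apply, G]
          linarith
        rw [h3]
        simpa only [Finset.sum_apply] using h2
      · intro M
        refine (fblNorm_sum_le hp.out _ _).trans ?_
        refine (Finset.sum_le_sum fun k _ => hg1 (k + N)).trans ?_
        rw [← ENNReal.ofReal_sum_of_nonneg fun k _ => by positivity]
        refine ENNReal.ofReal_le_ofReal ?_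
        simp_rw [pow_add]
        rw [← Finset.sum_mul]
        refine mul_le_mul_of_nonneg_right ?_ (by positivity)
        exact sum_geometric_two_le M
    have hGfin : G ∈ finiteNormFun E p := by
      refine ⟨hGpos, ?_⟩
      have := htail 0
      simp only [Finset.range_zero, Finset.sum_empty, sub_zero] at this
      exact this.trans_lt ENNReal.ofReal_lt_top
    have hGmem : G ∈ freeBanachLattice E p := by
      refine hcl.closed G hGfin fun ε hε => ?_
      have hlim : Filter.Tendsto (fun N : ℕ => ENNReal.ofReal (2 * (1 / 2 : ℝ) ^ N))
          Filter.atTop (nhds 0) := by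
        have := (tendsto_pow_atTop_nhds_zero_of_lt_one (r := (1 / 2 : ℝ))
          (by norm_num) (by norm_num)).const_mul 2
        simpa using ENNReal.tendsto_ofReal this
      obtain ⟨N, hN⟩ := (hlim.eventually (gt_mem_nhds hε)).exists
      exact ⟨_, sum_mem fun k _ => (g k).2, (htail N).trans_lt hN⟩
    obtain ⟨N, hN⟩ := exists_nat_gt (φ ⟨G, hGmem⟩)
    have h1 : φ (∑ k ∈ Finset.range N, g k) ≤ φ ⟨G, hGmem⟩ := by
      refine hmono _ _ fun y => ?_
      simp only [Submodule.coe_sum, Finset.sum_apply]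
      exact (hsum y).sum_le_tsum _ fun k _ => hg0 k y
    have h2 : (N : ℝ) ≤ φ (∑ k ∈ Finset.range N, g k) := by
      rw [map_sum]
      calc (N : ℝ) = ∑ k ∈ Finset.range N, (1 : ℝ) := by simp
        _ ≤ _ := Finset.sum_le_sum fun k _ => hg2 k
    linarith
  obtain ⟨n, hn⟩ := claim
  refine ⟨2 ^ n, by positivity, fun f => ?_⟩
  set c := (fblNorm p (f : StrongDual ℝ E → ℝ)).toReal with hc
  have hfin := (hcl.le f.2).2
  have habs : ∀ y, ((f ⊔ -f : freeBanachLattice E p) : StrongDual ℝ E → ℝ) y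
      = |(f : StrongDual ℝ E → ℝ) y| := fun y => rfl
  have hφabs : φ (f ⊔ -f) = |φ f| := by rw [hφ, map_neg]; rfl
  have hc0 : 0 ≤ c := ENNReal.toReal_nonneg
  rcases eq_or_lt_of_le hc0 with h0 | h0
  · have hz : fblNorm p (f : StrongDual ℝ E → ℝ) = 0 := by
      rcases (ENNReal.toReal_eq_zero_iff _).1 h0.symm with h | h
      · exact h
      · exact absurd h hfin.ne
    have : f = 0 := by
      ext y
      have := ofReal_abs_le_fblNorm hp.out (hcl.le f.2).1 y
      rw [hz, mul_zero, nonpos_iff_eq_zero, ENNReal.ofReal_eq_zero] at this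
      exact abs_nonpos_iff.1 this
    rw [this, map_zero, abs_zero]
    positivity
  · have h1 := hn (c⁻¹ • (f ⊔ -f)) (fun y => mul_nonneg (by positivity)
      (by rw [habs]; exact abs_nonneg _)) (by
        refine (fblNorm_smul_le hp.out _ _).trans ?_
        have h3 : fblNorm p ((f ⊔ -f : freeBanachLattice E p) : StrongDual ℝ E → ℝ)
            ≤ ENNReal.ofReal c := by
          rw [hc, ENNReal.ofReal_toReal hfin.ne]
          exact fblNorm_mono hp.out fun y => by rw [habs, abs_abs]
        calc _ ≤ ENNReal.ofReal |c⁻¹| * ENNReal.ofReal c := by gcongr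
          _ = 1 := by
            rw [← ENNReal.ofReal_mul (abs_nonneg _), abs_of_pos (by positivity),
              inv_mul_cancel₀ h0.ne', ENNReal.ofReal_one])
    rw [map_smul, hφabs, smul_eq_mul, inv_mul_le_iff₀ h0] at h1
    linarith

/-- Linear functionals on `FBL^p[E]` which preserve suprema and infima and agree on the
generators are equal. -/
theorem functional_eq_of_eq_on_canonicalMap {p : ℝ} [hp : Fact (1 ≤ p)]
    (φ ψ : freeBanachLattice E p →ₗ[ℝ] ℝ)
    (hφ : ∀ f g, φ (f ⊔ g) = φ f ⊔ φ g) (hφ' : ∀ f g, φ (f ⊓ g) = φ f ⊓ φ g)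
    (hψ : ∀ f g, ψ (f ⊔ g) = ψ f ⊔ ψ g) (hψ' : ∀ f g, ψ (f ⊓ g) = ψ f ⊓ ψ g)
    (h : ∀ x, φ (canonicalMap E p x) = ψ (canonicalMap E p x)) : φ = ψ := by
  have hcl := isClosedSublattice_freeBanachLattice (E := E) p
  obtain ⟨C, hC0, hC⟩ := exists_bound_of_map_sup φ hφ
  obtain ⟨D, hD0, hD⟩ := exists_bound_of_map_sup ψ hψ
  let A : Submodule ℝ (StrongDual ℝ E → ℝ) :=
    (LinearMap.eqLocus φ ψ).map (freeBanachLattice E p).subtype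
  have hA : IsClosedSublattice p A := by
    refine ⟨?_, ?_, ?_, ?_⟩
    · rintro _ ⟨f, -, rfl⟩
      exact hcl.le f.2
    · rintro _ ⟨f, hf, rfl⟩ _ ⟨g, hg, rfl⟩
      refine ⟨f ⊔ g, ?_, rfl⟩
      simp only [SetLike.mem_coe, LinearMap.mem_eqLocus] at *
      rw [hφ, hψ, hf, hg]
    · rintro _ ⟨f, hf, rfl⟩ _ ⟨g, hg, rfl⟩
      refine ⟨f ⊓ g, ?_, rfl⟩
      simp only [SetLike.mem_coe, LinearMap.mem_eqLocus] at *
      rw [hφ', hψ', hf, hg]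
    · intro f hf happ
      have hfm : f ∈ freeBanachLattice E p := hcl.closed f hf fun ε hε => by
        obtain ⟨_, ⟨g, -, rfl⟩, hlt⟩ := happ ε hε
        exact ⟨_, g.2, hlt⟩
      refine ⟨⟨f, hfm⟩, ?_, rfl⟩
      simp only [SetLike.mem_coe, LinearMap.mem_eqLocus]
      refine eq_of_forall_dist_le fun ε hε => ?_
      rw [Real.dist_eq]
      have hpos : 0 < ε / (C + D + 1) := by positivity
      obtain ⟨_, ⟨g, hg, rfl⟩, hlt⟩ := happ (ENNReal.ofReal (ε / (C + D + 1)))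
        (ENNReal.ofReal_pos.2 hpos)
      simp only [SetLike.mem_coe, LinearMap.mem_eqLocus] at hg
      have h1 := hC (⟨f, hfm⟩ - g)
      have h2 := hD (⟨f, hfm⟩ - g)
      have h3 : (fblNorm p ((⟨f, hfm⟩ - g : freeBanachLattice E p) :
          StrongDual ℝ E → ℝ)).toReal ≤ ε / (C + D + 1) :=
        ENNReal.toReal_le_of_le_ofReal hpos.le hlt.le
      have h4 : φ ⟨f, hfm⟩ - ψ ⟨f, hfm⟩ = φ (⟨f, hfm⟩ - g) - ψ (⟨f, hfm⟩ - g) := by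
        rw [map_sub, map_sub, hg]; ring
      rw [h4]
      calc _ ≤ |φ (⟨f, hfm⟩ - g)| + |ψ (⟨f, hfm⟩ - g)| := abs_sub _ _
        _ ≤ C * (ε / (C + D + 1)) + D * (ε / (C + D + 1)) := by
          refine add_le_add (h1.trans ?_) (h2.trans ?_) <;> gcongr
        _ = ε * ((C + D) / (C + D + 1)) := by ring
        _ ≤ ε * 1 := by
          gcongr
          rw [div_le_one (by positivity)]
          linarith
        _ = ε := mul_one ε
  ext f
  obtain ⟨g, hg, hgf⟩ := freeBanachLattice_le hA
    (fun x => ⟨canonicalMap E p x, h x, rfl⟩) f.2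
  have : g = f := Subtype.ext hgf
  rw [← this]
  exact hg

variable (E) in
/-- Evaluation at a point of the dual of `E`, as a linear functional on `FBL^p[E]`. -/
def evalAt (p : ℝ) [Fact (1 ≤ p)] (y : StrongDual ℝ E) : freeBanachLattice E p →ₗ[ℝ] ℝ :=
  LinearMap.proj y ∘ₗ (freeBanachLattice E p).subtype

end Construction

section Maps

variable {E F : Type*} [NormedAddCommGroup E] [NormedSpace ℝ E]
  [NormedAddCommGroup F] [NormedSpace ℝ F]

/-- Every lattice homomorphism `T : FBL^p[E] → FBL^p[F]` is composition with a unique map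
between the dual spaces. -/
theorem existsUnique_inducedMap {p : ℝ} [hp : Fact (1 ≤ p)]
    (T : VectorLatticeHom (freeBanachLattice E p) (freeBanachLattice F p)) :
    ∃! Φ : StrongDual ℝ F → StrongDual ℝ E, ∀ f : freeBanachLattice E p,
      (T f : StrongDual ℝ F → ℝ) = (f : StrongDual ℝ E → ℝ) ∘ Φ := by
  have hsup : ∀ y f g, (evalAt F p y ∘ₗ T.toLinearMap) (f ⊔ g)
      = (evalAt F p y ∘ₗ T.toLinearMap) f ⊔ (evalAt F p y ∘ₗ T.toLinearMap) g := fun y f g =>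
    congrArg (evalAt F p y) (T.map_sup' f g)
  have hinf : ∀ y f g, (evalAt F p y ∘ₗ T.toLinearMap) (f ⊓ g)
      = (evalAt F p y ∘ₗ T.toLinearMap) f ⊓ (evalAt F p y ∘ₗ T.toLinearMap) g := fun y f g =>
    congrArg (evalAt F p y) (T.map_inf' f g)
  choose C hC0 hC using fun y => exists_bound_of_map_sup (evalAt F p y ∘ₗ T.toLinearMap) (hsup y)
  let Φ : StrongDual ℝ F → StrongDual ℝ E := fun y =>
    LinearMap.mkContinuous ((evalAt F p y ∘ₗ T.toLinearMap) ∘ₗ canonicalMap E p) (C y) fun x => by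
      refine (hC y _).trans (mul_le_mul_of_nonneg_left ?_ (hC0 y))
      exact ENNReal.toReal_le_of_le_ofReal (norm_nonneg _) (fblNorm_evalFun_le hp.out x)
  refine ⟨Φ, fun f => ?_, fun Ψ hΨ => ?_⟩
  · funext y
    have := functional_eq_of_eq_on_canonicalMap (evalAt F p y ∘ₗ T.toLinearMap)
      (evalAt E p (Φ y)) (hsup y) (hinf y) (fun _ _ => rfl) (fun _ _ => rfl) (fun _ => rfl)
    exact LinearMap.congr_fun this f
  · funext y
    ext x
    exact (congrFun (hΨ (canonicalMap E p x)) y).symm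

/-- The map `Φ_T : F* → E*` induced by a lattice homomorphism `T : FBL^p[E] → FBL^p[F]`:
the unique map with `T f = f ∘ Φ_T` for all `f`. -/
noncomputable def inducedMap {p : ℝ} [Fact (1 ≤ p)]
    (T : VectorLatticeHom (freeBanachLattice E p) (freeBanachLattice F p)) :
    StrongDual ℝ F → StrongDual ℝ E :=
  (existsUnique_inducedMap T).choose

theorem inducedMap_spec {p : ℝ} [Fact (1 ≤ p)]
    (T : VectorLatticeHom (freeBanachLattice E p) (freeBanachLattice F p))
    (f : freeBanachLattice E p) :
    (T f : StrongDual ℝ F → ℝ) = (f : StrongDual ℝ E → ℝ) ∘ inducedMap T :=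
  (existsUnique_inducedMap T).choose_spec.1 f

theorem comp_adjoint_mem (p : ℝ) [hp : Fact (1 ≤ p)] (S : E →L[ℝ] F)
    {f : StrongDual ℝ E → ℝ} (hf : f ∈ freeBanachLattice E p) :
    (fun y : StrongDual ℝ F => f (y.comp S)) ∈ freeBanachLattice F p := by
  have hcl := isClosedSublattice_freeBanachLattice (E := F) p
  have hE := isClosedSublattice_finiteNormFun (E := E) p
  have hc : 0 < ‖S‖ + 1 := by positivity
  have hbd : ∀ f ∈ posHomFun E, fblNorm p (fun y : StrongDual ℝ F => f (y.comp S))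
      ≤ ENNReal.ofReal (‖S‖ + 1) * fblNorm p f := by
    intro f hf
    rw [fblNorm_le_iff]
    intro n ys hys
    have h1 : weakSummingNorm p (fun j => (‖S‖ + 1)⁻¹ • (ys j).comp S) ≤ 1 := by
      simp only [weakSummingNorm, iSup_le_iff] at hys ⊢
      intro x hx
      refine le_trans (le_of_eq ?_) (hys ((‖S‖ + 1)⁻¹ • S x) ?_)
      · simp
      · rw [norm_smul, norm_inv, Real.norm_of_nonneg hc.le, inv_mul_le_iff₀ hc, mul_one]
        have := S.le_opNorm x
        nlinarith [norm_nonneg S, norm_nonneg x]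
    have h2 : (fun j => f ((ys j).comp S))
        = fun j => (‖S‖ + 1) * f ((‖S‖ + 1)⁻¹ • (ys j).comp S) := by
      funext j
      rw [← hf _ _ hc.le, smul_smul, mul_inv_cancel₀ hc.ne', one_smul]
    rw [h2, lpSum_smul hp.out, abs_of_pos hc, ENNReal.ofReal_mul hc.le]
    gcongr
    exact le_fblNorm f _ h1
  let L : (StrongDual ℝ E → ℝ) →ₗ[ℝ] (StrongDual ℝ F → ℝ) :=
    LinearMap.funLeft ℝ ℝ fun y : StrongDual ℝ F => y.comp S
  have hA : IsClosedSublattice p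
      (finiteNormFun E p ⊓ (freeBanachLattice F p).comap L) := by
    refine ⟨inf_le_left, fun f hf g hg => ⟨hE.sup_mem f hf.1 g hg.1, ?_⟩,
      fun f hf g hg => ⟨hE.inf_mem f hf.1 g hg.1, ?_⟩, fun f hf happ => ⟨hf, ?_⟩⟩
    · exact hcl.sup_mem _ hf.2 _ hg.2
    · exact hcl.inf_mem _ hf.2 _ hg.2
    · refine hcl.closed _ ⟨?_, ?_⟩ fun ε hε => ?_
      · intro r y hr
        exact hf.1 r (y.comp S) hr
      · exact (hbd f hf.1).trans_lt (ENNReal.mul_lt_top ENNReal.ofReal_lt_top hf.2)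
      · have hc' : ENNReal.ofReal (‖S‖ + 1) ≠ 0 := (ENNReal.ofReal_pos.2 hc).ne'
        obtain ⟨g, hg, hlt⟩ := happ (ε / ENNReal.ofReal (‖S‖ + 1))
          (ENNReal.div_pos hε.ne' ENNReal.ofReal_ne_top)
        refine ⟨L g, hg.2, ?_⟩
        have h1 := hbd (f - g) (sub_mem hf.1 hg.1.1)
        refine h1.trans_lt ?_
        rw [mul_comm]
        exact (ENNReal.lt_div_iff_mul_lt (Or.inl hc') (Or.inl ENNReal.ofReal_ne_top)).1 hlt
  refine (freeBanachLattice_le hA (fun x => ⟨evalFun_mem_finiteNormFun p x, ?_⟩) hf).2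
  exact (canonicalMap F p (S x)).2

/-- For a bounded operator `S : E → F` there is a unique lattice homomorphism
`U : FBL^p[E] → FBL^p[F]` with `U ∘ δ^E = δ^F ∘ S`. -/
theorem existsUnique_inducedHom (p : ℝ) [Fact (1 ≤ p)] (S : E →L[ℝ] F) :
    ∃! U : VectorLatticeHom (freeBanachLattice E p) (freeBanachLattice F p),
      ⇑U ∘ canonicalMap E p = canonicalMap F p ∘ S := by
  refine ⟨⟨⟨⟨fun f => ⟨_, comp_adjoint_mem p S f.2⟩, fun _ _ => rfl⟩, fun _ _ => rfl⟩,
    fun _ _ => rfl, fun _ _ => rfl⟩, rfl, fun U hU => ?_⟩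
  refine VectorLatticeHom.ext_fun fun f => Subtype.ext (funext fun y => ?_)
  have := functional_eq_of_eq_on_canonicalMap (evalAt F p y ∘ₗ U.toLinearMap)
    (evalAt E p (y.comp S))
    (fun f g => congrArg (evalAt F p y) (U.map_sup' f g))
    (fun f g => congrArg (evalAt F p y) (U.map_inf' f g))
    (fun _ _ => rfl) (fun _ _ => rfl)
    (fun x => congrArg (evalAt F p y) (congrFun hU x))
  exact LinearMap.congr_fun this f

/-- The lattice homomorphism `FBL^p[E] → FBL^p[F]` induced by a bounded operator `S : E → F`:
the unique lattice homomorphism whose composition with `δ^E` is `δ^F ∘ S`. -/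
noncomputable def inducedHom (p : ℝ) [Fact (1 ≤ p)] (S : E →L[ℝ] F) :
    VectorLatticeHom (freeBanachLattice E p) (freeBanachLattice F p) :=
  (existsUnique_inducedHom p S).choose

theorem inducedHom_spec (p : ℝ) [Fact (1 ≤ p)] (S : E →L[ℝ] F) :
    ⇑(inducedHom p S) ∘ canonicalMap E p = canonicalMap F p ∘ S :=
  (existsUnique_inducedHom p S).choose_spec.1

end Maps

/-! The substance is that linearity of `Φ_T` forces it to be an adjoint. Since `(T δ_x)(y) =
Φ_T(y)(x)`, linearity of `Φ_T` makes every `T δ_x` a linear member of `FBL^p[F]`, so it is enough to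
know that such members are evaluations `δ_z`.

For this, call `f` almost finitely determined if for each `ε > 0` there is a finite `s ⊆ F` with `|f
y| ≤ ε ‖y‖` for all `y` annihilating `s`. Evaluations have this property, and it survives linear
combinations, finite suprema and infima, and norm limits; hence all of `FBL^p[F]` has it
(`freeBanachLattice_le_almostFinitelyDetermined`). If `f` is also linear, Hahn–Banach replaces it,
up to an error of norm at most `ε`, by a functional vanishing on the annihilator of `s`, which is a
combination of evaluations at points of `s`. So `f` lies in the closure of the image of `F` in its
bidual, and that image is closed because `F` is complete.

The resulting map `x ↦ z` is linear because `F*` separates points, and bounded by the closed graph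
theorem. The other equivalences hold with the same `S`: evaluate at points of `E` and `F*`, and use
the uniqueness of the homomorphism induced by `S`. -/

/-! ### Linear members of the free Banach lattice -/

section LinearMembers

variable {F : Type*} [NormedAddCommGroup F] [NormedSpace ℝ F]

variable (F) in
/-- The functions on the dual of `F` which, up to an arbitrarily small multiple of the norm,
vanish on the annihilator of a finite subset of `F`. -/
def almostFinitelyDetermined : Submodule ℝ (StrongDual ℝ F → ℝ) where
  carrier := {f | ∀ ε : ℝ, 0 < ε → ∃ s : Finset F, ∀ y : StrongDual ℝ F,
    (∀ z ∈ s, y z = 0) → |f y| ≤ ε * ‖y‖}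
  add_mem' := by
    classical
    intro f g hf hg ε hε
    obtain ⟨s, hs⟩ := hf (ε / 2) (half_pos hε)
    obtain ⟨t, ht⟩ := hg (ε / 2) (half_pos hε)
    refine ⟨s ∪ t, fun y hy => (abs_add_le _ _).trans ?_⟩
    have h1 := hs y fun z hz => hy z (Finset.mem_union_left _ hz)
    have h2 := ht y fun z hz => hy z (Finset.mem_union_right _ hz)
    linarith
  zero_mem' := fun ε hε => ⟨∅, fun y _ => by simp only [Pi.zero_apply, abs_zero]; positivity⟩
  smul_mem' := by
    intro c f hf ε hε
    -- Dividing by `|c| + 1` rather than `|c|` covers `c = 0`.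
    have hc : 0 < |c| + 1 := by positivity
    obtain ⟨s, hs⟩ := hf (ε / (|c| + 1)) (by positivity)
    refine ⟨s, fun y hy => ?_⟩
    rw [Pi.smul_apply, smul_eq_mul, abs_mul]
    calc |c| * |f y| ≤ (|c| + 1) * (ε / (|c| + 1) * ‖y‖) := by
          gcongr
          · linarith
          · exact hs y hy
      _ = ε * ‖y‖ := by field_simp

/-- On the annihilator of the union of the two finite sets both bounds hold at once. A maximum does
not add errors, so `ε` need not be split. This serves suprema and infima alike. -/
theorem almostFinitelyDetermined_of_abs_le_max {f g h : StrongDual ℝ F → ℝ}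
    (hf : f ∈ almostFinitelyDetermined F) (hg : g ∈ almostFinitelyDetermined F)
    (hle : ∀ y, |h y| ≤ max |f y| |g y|) : h ∈ almostFinitelyDetermined F := by
  classical
  intro ε hε
  obtain ⟨s, hs⟩ := hf ε hε
  obtain ⟨t, ht⟩ := hg ε hε
  exact ⟨s ∪ t, fun y hy => (hle y).trans (max_le
    (hs y fun z hz => hy z (Finset.mem_union_left _ hz))
    (ht y fun z hz => hy z (Finset.mem_union_right _ hz)))⟩

/-- The real-valued form of the one-element-family bound. It carries almost finite determination to
norm limits, and makes linear members continuous. -/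
theorem abs_le_norm_mul_fblNorm {p : ℝ} [hp : Fact (1 ≤ p)] {f : StrongDual ℝ F → ℝ}
    (hf : f ∈ finiteNormFun F p) (y : StrongDual ℝ F) :
    |f y| ≤ (fblNorm p f).toReal * ‖y‖ := by
  have h := ofReal_abs_le_fblNorm hp.out hf.1 y
  rw [← ENNReal.ofReal_toReal hf.2.ne, ← ENNReal.ofReal_mul (norm_nonneg _),
    ENNReal.ofReal_le_ofReal_iff (by positivity)] at h
  linarith

theorem isClosedSublattice_almostFinitelyDetermined (p : ℝ) [Fact (1 ≤ p)] :
    IsClosedSublattice p (finiteNormFun F p ⊓ almostFinitelyDetermined F) := by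
  have hF := isClosedSublattice_finiteNormFun (E := F) p
  refine ⟨inf_le_left, fun f hf g hg => ⟨hF.sup_mem f hf.1 g hg.1, ?_⟩,
    fun f hf g hg => ⟨hF.inf_mem f hf.1 g hg.1, ?_⟩, fun f hf happ => ⟨hf, fun ε hε => ?_⟩⟩
  · exact almostFinitelyDetermined_of_abs_le_max hf.2 hg.2 fun y => abs_max_le_max_abs_abs
  · exact almostFinitelyDetermined_of_abs_le_max hf.2 hg.2 fun y => abs_min_le_max_abs_abs
  -- Half of `ε` pays for replacing `f` by `g`, the other half for `g` on the annihilator of its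
  -- finite set, which then serves for `f`.
  · obtain ⟨g, hg, hlt⟩ := happ (ENNReal.ofReal (ε / 2)) (ENNReal.ofReal_pos.2 (half_pos hε))
    obtain ⟨s, hs⟩ := hg.2 (ε / 2) (half_pos hε)
    refine ⟨s, fun y hy => ?_⟩
    have h1 := abs_le_norm_mul_fblNorm (sub_mem hf hg.1) y
    have h2 : (fblNorm p (f - g)).toReal ≤ ε / 2 :=
      ENNReal.toReal_le_of_le_ofReal (half_pos hε).le hlt.le
    have h3 := mul_le_mul_of_nonneg_right h2 (norm_nonneg y)
    have h4 : f y = (f - g) y + g y := by simp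
    rw [h4]
    refine (abs_add_le _ _).trans ?_
    linarith [hs y hy]

/-- By minimality only the generators need checking, and `δ_x` vanishes on the annihilator of `{x}`.
-/
theorem freeBanachLattice_le_almostFinitelyDetermined (p : ℝ) [Fact (1 ≤ p)] :
    freeBanachLattice F p ≤ almostFinitelyDetermined F :=
  (freeBanachLattice_le (isClosedSublattice_almostFinitelyDetermined p) fun x =>
    ⟨evalFun_mem_finiteNormFun p x, fun ε hε => ⟨{x}, fun y hy => by
      rw [evalFun, hy x (Finset.mem_singleton_self x), abs_zero]; positivity⟩⟩).trans inf_le_right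

/-- A bounded linear functional on the dual of a Banach space which is almost determined by
finitely many evaluations is an evaluation. -/
theorem exists_eq_evalFun_of_almostFinitelyDetermined [CompleteSpace F]
    (φ : StrongDual ℝ (StrongDual ℝ F)) (hφ : ⇑φ ∈ almostFinitelyDetermined F) :
    ∃ z : F, ∀ y : StrongDual ℝ F, φ y = y z := by
  let J := NormedSpace.inclusionInDoubleDualLi ℝ (E := F)
  -- Completeness of `F` enters here: an isometric image of a complete space is complete.
  have hclosed : IsClosed (Set.range J) := by
    exact J.isometry.isUniformInducing.isComplete_range.isClosed
  have hmem : φ ∈ Set.range J := by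
    refine hclosed.closure_subset ((Metric.mem_closure_iff (α := StrongDual ℝ (StrongDual ℝ F))).2 fun ε hε => ?_)
    obtain ⟨s, hs⟩ := hφ (ε / 2) (half_pos hε)
    let N : Submodule ℝ (StrongDual ℝ F) :=
      ⨅ z : s, LinearMap.ker (J z : StrongDual ℝ (StrongDual ℝ F)).toLinearMap
    have hN : ∀ y ∈ N, |φ y| ≤ ε / 2 * ‖y‖ := fun y hy => hs y fun z hz =>
      (Submodule.mem_iInf _).1 hy ⟨z, hz⟩
    -- Hahn–Banach: `φ` is small on the annihilator `N` of `s`, so its restriction extends to a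
    -- small `ψ` on all of `F*`.
    obtain ⟨ψ, hψ, hψn⟩ := exists_extension_norm_eq N (φ.comp N.subtypeL)
    have hψ' : ‖ψ‖ ≤ ε / 2 := by
      rw [hψn]
      exact ContinuousLinearMap.opNorm_le_bound _ (half_pos hε).le fun y => hN y y.2
    -- `φ - ψ` vanishes on the intersection of the kernels of finitely many evaluations, hence is a
    -- linear combination of them.
    have hspan := mem_span_of_iInf_ker_le_ker (𝕜 := ℝ)
      (L := fun z : s => (J z : StrongDual ℝ (StrongDual ℝ F)).toLinearMap)
      (K := (φ - ψ).toLinearMap) (fun y hy => by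
        have := hψ ⟨y, hy⟩
        simp only [ContinuousLinearMap.comp_apply, Submodule.subtypeL_apply] at this
        simp [this])
    obtain ⟨c, hc⟩ := (Submodule.mem_span_range_iff_exists_fun ℝ).1 hspan
    refine ⟨_, ⟨∑ z : s, c z • (z : F), rfl⟩, ?_⟩
    have : J (∑ z : s, c z • (z : F)) = φ - ψ := by
      ext y
      have hy := LinearMap.congr_fun hc y
      rw [LinearMap.sum_apply] at hy
      change y (∑ z : s, c z • (z : F)) = (φ - ψ) y
      rw [map_sum]
      exact (Finset.sum_congr rfl fun z _ => y.map_smul (c z) (z : F)).trans hy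
    rw [this]
    refine (dist_eq_norm (E := StrongDual ℝ (StrongDual ℝ F)) _ _).trans_lt ?_
    have hsub : φ - (φ - ψ) = ψ := by ext y; simp
    rw [hsub]
    linarith
  obtain ⟨z, rfl⟩ := hmem
  exact ⟨z, fun y => rfl⟩

/-- The linear members of `FBL^p[F]` are the evaluations. -/
theorem exists_eq_evalFun_of_isLinearMap [CompleteSpace F] {p : ℝ} [Fact (1 ≤ p)]
    {f : StrongDual ℝ F → ℝ} (hf : f ∈ freeBanachLattice F p) (hlin : IsLinearMap ℝ f) :
    ∃ z : F, f = evalFun z := by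
  obtain ⟨z, hz⟩ := exists_eq_evalFun_of_almostFinitelyDetermined
    ((IsLinearMap.mk' f hlin).mkContinuous _ fun y =>
      abs_le_norm_mul_fblNorm ((isClosedSublattice_freeBanachLattice p).le hf) y)
    (freeBanachLattice_le_almostFinitelyDetermined p hf)
  exact ⟨z, funext hz⟩

end LinearMembers

/-! ### Adjoints and the equivalence -/

section Maps

variable {E F : Type*} [NormedAddCommGroup E] [NormedSpace ℝ E]
  [NormedAddCommGroup F] [NormedSpace ℝ F]

theorem canonicalMap_apply_inducedMap {p : ℝ} [Fact (1 ≤ p)]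
    (T : VectorLatticeHom (freeBanachLattice E p) (freeBanachLattice F p))
    (x : E) (y : StrongDual ℝ F) :
    (T (canonicalMap E p x) : StrongDual ℝ F → ℝ) y = inducedMap T y x :=
  congrFun (inducedMap_spec T (canonicalMap E p x)) y

/-- Both sides say that `(T δ_x)(y) = y (S x)` for all `x` and `y`. -/
theorem comp_canonicalMap_eq_iff {p : ℝ} [Fact (1 ≤ p)]
    (T : VectorLatticeHom (freeBanachLattice E p) (freeBanachLattice F p)) (S : E →L[ℝ] F) :
    ⇑T ∘ canonicalMap E p = canonicalMap F p ∘ S ↔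
      inducedMap T = fun y : StrongDual ℝ F => y.comp S := by
  refine ⟨fun h => ?_, fun h => ?_⟩
  · funext y
    ext x
    rw [← canonicalMap_apply_inducedMap T x y]
    exact congrArg (fun f : freeBanachLattice F p => (f : StrongDual ℝ F → ℝ) y) (congrFun h x)
  · funext x
    refine Subtype.ext (funext fun y => ?_)
    refine (canonicalMap_apply_inducedMap T x y).trans ?_
    rw [h]
    rfl

/-- A map between duals is the adjoint of a bounded operator if pointwise it is an evaluation. -/
theorem exists_adjoint_eq_of_forall_exists [CompleteSpace E] [CompleteSpace F]
    (Φ : StrongDual ℝ F → StrongDual ℝ E) (h : ∀ x : E, ∃ z : F, ∀ y, Φ y x = y z) :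
    ∃ S : E →L[ℝ] F, Φ = fun y : StrongDual ℝ F => y.comp S := by
  choose s hs using h
  -- `Φ` itself need not be linear: linearity in `x` comes from each functional `Φ y`, and `F*`
  -- separates the points of `F`.
  let S : E →ₗ[ℝ] F :=
    { toFun := s
      map_add' := fun x x' => (SeparatingDual.eq_iff_forall_dual_eq (R := ℝ)).2 fun y => by
        rw [map_add, ← hs, ← hs, ← hs, map_add]
      map_smul' := fun c x => (SeparatingDual.eq_iff_forall_dual_eq (R := ℝ)).2 fun y => by
        rw [map_smul, ← hs, ← hs, map_smul, RingHom.id_apply] }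
  -- Closed graph: if `u n → x` and `S (u n) → z`, then `y (S (u n)) = Φ y (u n)` tends both to `y
  -- z` and to `Φ y x = y (S x)`.
  refine ⟨ContinuousLinearMap.ofSeqClosedGraph (g := S) fun u x z hu hz => ?_, ?_⟩
  · refine (SeparatingDual.eq_iff_forall_dual_eq (R := ℝ)).2 fun y => ?_
    have h1 := (y.continuous.tendsto z).comp hz
    have h2 := ((Φ y).continuous.tendsto x).comp hu
    have h3 : ⇑y ∘ ⇑S ∘ u = ⇑(Φ y) ∘ u := funext fun n => (hs (u n) y).symm
    rw [h3] at h1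
    exact (tendsto_nhds_unique h1 h2).trans (hs x y)
  · funext y
    ext x
    exact hs x y

end Maps

theorem propositionp {E F : Type*}
    [NormedAddCommGroup E] [NormedSpace ℝ E] [CompleteSpace E]
    [NormedAddCommGroup F] [NormedSpace ℝ F] [CompleteSpace F]
    (p : ℝ) [Fact (1 ≤ p)]
    (T : VectorLatticeHom (freeBanachLattice E p) (freeBanachLattice F p)) :
    List.TFAE [
      IsLinearMap ℝ (inducedMap T),
      ∃ S : E →L[ℝ] F, inducedMap T = fun y : StrongDual ℝ F => y.comp S,
      ∃ S : E →L[ℝ] F, ⇑T ∘ canonicalMap E p = canonicalMap F p ∘ S,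
      ∃ S : E →L[ℝ] F, T = inducedHom p S] := by
  tfae_have 1 → 2 := fun h => by
    refine exists_adjoint_eq_of_forall_exists _ fun x => ?_
    -- `T δ_x` is `Φ_T` followed by evaluation at `x`, so it inherits linearity.
    obtain ⟨z, hz⟩ := exists_eq_evalFun_of_isLinearMap (T (canonicalMap E p x)).2 <| by
      constructor <;> intros <;>
        simp only [canonicalMap_apply_inducedMap, h.map_add, h.map_smul] <;> rfl
    exact ⟨z, fun y => (canonicalMap_apply_inducedMap T x y).symm.trans (congrFun hz y)⟩
  tfae_have 2 → 1 := by
    rintro ⟨S, hS⟩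
    rw [hS]
    exact ⟨fun _ _ => rfl, fun _ _ => rfl⟩
  tfae_have 2 ↔ 3 := exists_congr fun S => (comp_canonicalMap_eq_iff T S).symm
  tfae_have 3 ↔ 4 := exists_congr fun S =>
    ⟨fun h => (existsUnique_inducedHom p S).unique h (inducedHom_spec p S),
      fun h => h ▸ inducedHom_spec p S⟩
  tfae_finish
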